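/- Conventions. A \emph{metric probability space} $(X,\nu)$ is a metric space $(X,d)$ with a probability measure $\nu$ on its Borel $\sigma$-algebra. All distances below take values in $[0,\infty]$, and $\inf\emptyset=\infty$. Let $T=(0,\infty)^{op}\times[0,\infty)$, so $(m,r)\le(m',r')$ iff $m'\le m$ and $r\le r'$. Let $\mathbf{Top}$ be the category of compactly generated weakly Hausdorff spaces and continuous maps. The \emph{measure Dowker bifiltration} $\mathcal{MD}(X,\nu)$ assigns to $(m,r)\in T$ the abstract simplicial complex consisting of all non-empty finite $\sigma\subseteq X$ with $$\nu\big(\{y\in X : d(x,y)\le 2r\text{ for all }x\in\sigma\}\big)\ge m,$$ with inclusions as structure maps; via geometric realization (with the weak topology) it is regarded as a functor $T\to\mathbf{Top}$. Two functors $F,G\colon T\to\mathbf{Top}$ are \emph{objectwise equivalent} if there is a natural transformation $F\Rightarrow G$ all of whose components are homotopy equivalences, and \emph{weakly equivalent}, $F\simeq G$, if they are connected by a finite zigzag of objectwise equivalences. For $\delta>0$ they are \emph{$\delta$-interleaved} if there is a functor $Z\colon\mathbf I_\delta\to\mathbf{Top}$ which restricts to $F$ on $T\times\{0\}$ and to $G$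 on $T\times\{1\}$; here $\mathbf I_\delta$ is the thin category with objects $T\times\{0,1\}$ and a morphism $((m,r),i)\to((m',r'),j)$ iff either $i=j$ and $(m,r)\le(m',r')$, or $i\ne j$, $m'\le m-\delta$ and $r+\delta\le r'$. The \emph{homotopy interleaving distance} is $$d_{HI}(F,G)=\inf\{\delta>0 : \exists\,F'\simeq F,\ G'\simeq G\text{ such that }F',G'\text{ are }\delta\text{-interleaved}\}.$$ The \emph{Gromov--Hausdorff--Prokhorov distance} is $$d_{GHPr}\big((X_1,\nu_1),(X_2,\nu_2)\big)=\inf_{X_1\xrightarrow{\varphi}Z\xleftarrow{\psi}X_2}\max\{d_H(\varphi(X_1),\psi(X_2)),\,d_{Pr}(\varphi_\#\nu_1,\psi_\#\nu_2)\},$$ where the infimum ranges over all isometric embeddings $\varphi,\psi$ into a common complete separable metric space $Z$, and $d_H$, $d_{Pr}$ are the Hausdorff distance of subsets of $Z$ and the Prokhorov distance of Borel probability measures on $Z$. \textbf{Statement.} For any two metric probability spaces $(X_1,\nu_1)$ and $(X_2,\nu_2)$, $$d_{HI}\big(\mathcal{MD}(X_1,\nu_1),\mathcal{MD}(X_2,\nu_2)\big)\le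 d_{GHPr}\big((X_1,\nu_1),(X_2,\nu_2)\big).$$ -/

import Mathlib

open CategoryTheory MeasureTheory Topology
open scoped NNReal ENNReal

universe u

noncomputable section

namespace MeasureDowker

/-! ### Compactly generated weakly Hausdorff spaces -/

/-- A space is weakly Hausdorff if the image of every continuous map from a compact Hausdorff
space is closed. -/
def IsWeaklyHausdorff (X : Type u) [TopologicalSpace X] : Prop :=
  ∀ (S : Type u) [TopologicalSpace S] [CompactSpace S] [T2Space S] (f : S → X),
    Continuous f → IsClosed (Set.range f)

/-- The property of being compactly generated and weakly Hausdorff. -/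
def isCGWH : ObjectProperty TopCat.{u} :=
  fun X => CompactlyGeneratedSpace X ∧ IsWeaklyHausdorff X

/-- The category of compactly generated weakly Hausdorff spaces and continuous maps. -/
abbrev CGWH : Type (u + 1) := (isCGWH.{u}).FullSubcategory

/-! ### Geometric realization of abstract simplicial complexes -/

/-- Points of the geometric realization of `K`: finitely supported families of barycentric
coordinates whose support is a face of `K`. -/
structure Realization {V : Type u} (K : PreAbstractSimplicialComplex V) : Type u where
  weight : V →₀ ℝ
  nonneg : ∀ v, 0 ≤ weight v
  sum_eq_one : weight.sum (fun _ a => a) = 1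
  support_mem : weight.support ∈ K.faces

namespace Realization

variable {V : Type u}

/-- The closed simplex of the realization spanned by the finite set `σ`. -/
structure Simplex (K : PreAbstractSimplicialComplex V) (σ : Finset V) : Type u where
  point : Realization K
  support_subset : point.weight.support ⊆ σ

/-- The barycentric coordinates of a point of a closed simplex. -/
def Simplex.coord {K : PreAbstractSimplicialComplex V} {σ : Finset V} (p : Simplex K σ) : V → ℝ :=
  p.point.weight

/-- The Euclidean topology on a closed simplex. Only the finitely many coordinates in `σ` can be
non-zero, so the topology of pointwise convergence is the Euclidean one. -/
instance (K : PreAbstractSimplicialComplex V) (σ : Finset V) : TopologicalSpace (Simplex K σ) :=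
  TopologicalSpace.induced Simplex.coord inferInstance

/-- The inclusion of a closed simplex into the realization. -/
def Simplex.incl {K : PreAbstractSimplicialComplex V} {σ : Finset V} (p : Simplex K σ) :
    Realization K :=
  p.point

/-- The weak (coherent) topology: a set is open if and only if its intersection with every closed
simplex is open in that simplex. -/
instance (K : PreAbstractSimplicialComplex V) : TopologicalSpace (Realization K) :=
  ⨆ σ : {σ : Finset V // σ ∈ K.faces},
    TopologicalSpace.coinduced (Simplex.incl (K := K) (σ := σ.1)) inferInstance

lemma ext' {K : PreAbstractSimplicialComplex V} {p q : Realization K}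
    (h : p.weight = q.weight) : p = q := by
  cases p; cases q; cases h; rfl

lemma continuous_incl {K : PreAbstractSimplicialComplex V} {σ : Finset V} (hσ : σ ∈ K.faces) :
    Continuous (Simplex.incl (K := K) (σ := σ)) :=
  continuous_iff_coinduced_le.2
    (le_iSup (fun σ : {σ : Finset V // σ ∈ K.faces} =>
      TopologicalSpace.coinduced (Simplex.incl (K := K) (σ := σ.1)) inferInstance) ⟨σ, hσ⟩)

lemma continuous_iff {K : PreAbstractSimplicialComplex V} {Y : Type*} [TopologicalSpace Y]
    {f : Realization K → Y} :
    Continuous f ↔ ∀ σ ∈ K.faces, Continuous (f ∘ Simplex.incl (K := K) (σ := σ)) := by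
  constructor
  · intro h σ hσ
    exact h.comp (continuous_incl hσ)
  · intro h
    refine continuous_iSup_dom.2 fun σ => ?_
    exact continuous_coinduced_dom.2 (h σ.1 σ.2)

lemma continuous_weight (K : PreAbstractSimplicialComplex V) (v : V) :
    Continuous (fun p : Realization K => p.weight v) := by
  refine continuous_iff.2 fun σ _ => ?_
  exact (continuous_apply v).comp (continuous_induced_dom (f := Simplex.coord (K := K) (σ := σ)))

instance (K : PreAbstractSimplicialComplex V) : T2Space (Realization K) := by
  refine T2Space.of_injective_continuous (f := fun (p : Realization K) (v : V) => p.weight v) ?_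
    (continuous_pi (continuous_weight K))
  intro p q h
  exact ext' (Finsupp.ext fun v => congrFun h v)

lemma compactSpace_simplex {K : PreAbstractSimplicialComplex V} {σ : Finset V}
    (hσ : σ ∈ K.faces) : CompactSpace (Simplex K σ) := by
  classical
  have hind : IsInducing (Simplex.coord (K := K) (σ := σ)) := ⟨rfl⟩
  rw [← isCompact_univ_iff, hind.isCompact_iff, Set.image_univ]
  have hrange : Set.range (Simplex.coord (K := K) (σ := σ)) =
      (Set.univ.pi fun _ : V => Set.Icc (0 : ℝ) 1) ∩
        ({f | ∑ v ∈ σ, f v = 1} ∩ ⋂ v ∈ {v | v ∉ σ}, {f | f v = 0}) := by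
    ext f
    constructor
    · rintro ⟨p, rfl⟩
      have hsum : ∑ v ∈ σ, p.point.weight v = 1 := by
        rw [← p.point.sum_eq_one]
        exact (Finsupp.sum_of_support_subset _ p.2 (fun _ a => a) (fun _ _ => rfl)).symm
      have hzero : ∀ v, v ∉ σ → p.point.weight v = 0 := fun v hv => by
        by_contra h
        exact hv (p.2 (Finsupp.mem_support_iff.2 h))
      refine ⟨fun v _ => ⟨p.point.nonneg v, ?_⟩, hsum, ?_⟩
      · by_cases hv : v ∈ σ
        · change p.point.weight v ≤ 1
          rw [← hsum]
          exact Finset.single_le_sum (f := fun v => p.point.weight v)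
            (fun w _ => p.point.nonneg w) hv
        · change p.point.weight v ≤ 1
          rw [hzero v hv]
          exact zero_le_one
      · simp only [Set.mem_iInter]
        exact hzero
    · rintro ⟨h01, hsum, hzero⟩
      simp only [Set.mem_iInter] at hzero
      replace hzero : ∀ v, v ∉ σ → f v = 0 := hzero
      replace hsum : ∑ v ∈ σ, f v = 1 := hsum
      have hsupp : (Finsupp.onFinset σ f fun v hv => by
          by_contra h; exact hv (hzero v h)).support ⊆ σ := Finsupp.support_onFinset_subset
      have htot : (Finsupp.onFinset σ f fun v hv => by
          by_contra h; exact hv (hzero v h)).sum (fun _ a => a) = 1 := by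
        rw [Finsupp.sum_of_support_subset _ hsupp _ (fun _ _ => rfl)]
        exact hsum
      refine ⟨⟨⟨Finsupp.onFinset σ f fun v hv => by by_contra h; exact hv (hzero v h),
        fun v => (h01 v trivial).1, htot, (K.isRelLowerSet_faces hσ).2 hsupp ?_⟩, hsupp⟩, rfl⟩
      rw [Finset.nonempty_iff_ne_empty]
      intro h
      rw [Finsupp.sum, h] at htot
      simp at htot
  rw [hrange]
  refine (isCompact_univ_pi fun _ => isCompact_Icc).inter_right (IsClosed.inter ?_ ?_)
  · exact isClosed_eq (continuous_finsetSum _ fun v _ => continuous_apply v) continuous_const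
  · exact isClosed_biInter fun v _ => isClosed_eq (continuous_apply v) continuous_const

instance (K : PreAbstractSimplicialComplex V) (σ : Finset V) : T2Space (Simplex K σ) := by
  refine T2Space.of_injective_continuous (f := Simplex.coord (K := K) (σ := σ)) ?_
    continuous_induced_dom
  intro p q h
  cases p; cases q
  cases ext' (Finsupp.ext fun v => congrFun h v)
  rfl

lemma compactlyGenerated (K : PreAbstractSimplicialComplex V) :
    CompactlyGeneratedSpace (Realization K) := by
  refine compactlyGeneratedSpace_of_continuous_maps fun f hf => continuous_iff.2 fun σ hσ => ?_
  have := compactSpace_simplex hσ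
  exact hf (Simplex K σ) _ (continuous_incl hσ)

lemma isCGWH_of (K : PreAbstractSimplicialComplex V) : isCGWH (TopCat.of (Realization K)) :=
  ⟨compactlyGenerated K, fun _ _ _ _ _ hf => (isCompact_range hf).isClosed⟩

/-- The map of realizations induced by an inclusion of complexes. -/
def map {K L : PreAbstractSimplicialComplex V} (h : K ≤ L) (p : Realization K) :
    Realization L :=
  ⟨p.weight, p.nonneg, p.sum_eq_one, h p.support_mem⟩

lemma continuous_map {K L : PreAbstractSimplicialComplex V} (h : K ≤ L) :
    Continuous (map h) := by
  refine continuous_iff.2 fun σ hσ => ?_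
  have hg : Continuous (fun p : Simplex K σ => (⟨map h p.point, p.support_subset⟩ : Simplex L σ)) :=
    continuous_induced_rng.2 (continuous_induced_dom (f := Simplex.coord (K := K) (σ := σ)))
  exact (continuous_incl (h hσ)).comp hg

end Realization

/-- Geometric realization on the poset of simplicial complexes with vertices in `V`, ordered by
inclusion. -/
def realization (V : Type u) : PreAbstractSimplicialComplex V ⥤ CGWH.{u} where
  obj K := ⟨TopCat.of (Realization K), Realization.isCGWH_of K⟩
  map f := ObjectProperty.homMk
    (TopCat.ofHom ⟨Realization.map (leOfHom f), Realization.continuous_map (leOfHom f)⟩)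

/-! ### The measure Dowker bifiltration -/

/-- The indexing poset `(0, ∞)ᵒᵖ × [0, ∞)` of bifiltrations. -/
structure Bigrade : Type where
  mass : ℝ
  mass_pos : 0 < mass
  scale : ℝ≥0

instance : Preorder Bigrade where
  le s t := t.mass ≤ s.mass ∧ s.scale ≤ t.scale
  le_refl _ := ⟨le_rfl, le_rfl⟩
  le_trans _ _ _ h₁ h₂ := ⟨h₂.1.trans h₁.1, h₁.2.trans h₂.2⟩

/-- The measure Dowker bifiltration of a vertex set `X`, a measure space `(Y, μ)` and a function
`Λ`: at grade `(m, r)`, a non-empty finite set `σ ⊆ X` is a simplex if and only if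
`μ {y | Λ x y ≤ 2 r for all x ∈ σ} ≥ m`. -/
def measureDowkerOf {X Y : Type*} [MeasurableSpace Y] (μ : Measure Y) (Λ : X → Y → ℝ) :
    Bigrade →o PreAbstractSimplicialComplex X where
  toFun t :=
    { faces := {σ | σ.Nonempty ∧
        ENNReal.ofReal t.mass ≤ μ {y | ∀ x ∈ σ, Λ x y ≤ 2 * (t.scale : ℝ)}}
      isRelLowerSet_faces := fun _ hσ => ⟨hσ.1, fun _ hτσ hτ =>
        ⟨hτ, hσ.2.trans (measure_mono fun _ hy x hx => hy x (hτσ hx))⟩⟩ }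
  monotone' _ _ hst := fun _ hσ => ⟨hσ.1,
    (ENNReal.ofReal_le_ofReal hst.1).trans (hσ.2.trans (measure_mono fun _ hy x hx =>
      (hy x hx).trans (mul_le_mul_of_nonneg_left (NNReal.coe_le_coe.2 hst.2) zero_le_two)))⟩

/-- The measure Dowker bifiltration of a metric measure space, where `Λ` is the metric. -/
def measureDowker {X : Type*} [MetricSpace X] [MeasurableSpace X] (μ : Measure X) :
    Bigrade →o PreAbstractSimplicialComplex X :=
  measureDowkerOf μ (fun x y => dist x y)

/-- The filtered space obtained from a filtered complex by geometric realization. -/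
def realize {V : Type u} (F : Bigrade →o PreAbstractSimplicialComplex V) : Bigrade ⥤ CGWH.{u} :=
  F.monotone.functor ⋙ realization V

/-! ### The homotopy interleaving distance -/

/-- `F` and `G` are objectwise equivalent: there is a natural transformation from `F` to `G` all
of whose components are homotopy equivalences. -/
def ObjectwiseEquivalent (F G : Bigrade ⥤ CGWH.{u}) : Prop :=
  ∃ η : F ⟶ G, ∀ t : Bigrade,
    ∃ e : ContinuousMap.HomotopyEquiv (F.obj t).obj (G.obj t).obj, e.toFun = (η.app t).hom.hom

/-- Weak equivalence: a finite zigzag of objectwise equivalences. -/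
def WeaklyEquivalent (F G : Bigrade ⥤ CGWH.{u}) : Prop :=
  Relation.EqvGen ObjectwiseEquivalent F G

/-- Objects of the interleaving category for the shift `(m, r) ↦ (m - δ, r + δ)`: two copies of
the poset of bigrades. -/
structure InterleavingIndex (δ : ℝ≥0) : Type where
  grade : Bigrade
  side : Fin 2

/-- There is a (unique) morphism `(s, i) ⟶ (t, j)` if and only if `i = j` and `s ≤ t`, or `i ≠ j`
and the shift of `s` by `δ` is at most `t`, an inequality in `ℝᵒᵖ × [0, ∞)`. -/
instance (δ : ℝ≥0) : Preorder (InterleavingIndex δ) where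
  le a b := (a.side = b.side ∧ a.grade ≤ b.grade) ∨
    (a.side ≠ b.side ∧ b.grade.mass ≤ a.grade.mass - δ ∧ a.grade.scale + δ ≤ b.grade.scale)
  le_refl _ := Or.inl ⟨rfl, le_rfl⟩
  le_trans a b c hab hbc := by
    have hδ : (0 : ℝ) ≤ δ := δ.2
    have key : ∀ i j k : Fin 2, i ≠ j → j ≠ k → i = k := by decide
    rcases hab with ⟨h₁, h₂, h₃⟩ | ⟨h₁, h₂, h₃⟩ <;> rcases hbc with ⟨k₁, k₂, k₃⟩ | ⟨k₁, k₂, k₃⟩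
    · exact Or.inl ⟨h₁.trans k₁, k₂.trans h₂, h₃.trans k₃⟩
    · exact Or.inr ⟨h₁ ▸ k₁, by linarith, (add_le_add_left h₃ δ).trans k₃⟩
    · exact Or.inr ⟨k₁ ▸ h₁, by linarith, h₃.trans k₃⟩
    · exact Or.inl ⟨key _ _ _ h₁ k₁, by linarith,
        (le_self_add.trans h₃).trans (le_self_add.trans k₃)⟩

/-- The two inclusions of the poset of bigrades in the interleaving category. -/
def InterleavingIndex.incl (δ : ℝ≥0) (i : Fin 2) : Bigrade ⥤ InterleavingIndex δ :=
  Monotone.functor (f := fun t => (⟨t, i⟩ : InterleavingIndex δ))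
    (fun _ _ h => Or.inl ⟨rfl, h⟩)

/-- `F` and `G` are `δ`-interleaved. -/
def IsInterleaved (δ : ℝ≥0) (F G : Bigrade ⥤ CGWH.{u}) : Prop :=
  ∃ Z : InterleavingIndex δ ⥤ CGWH.{u},
    F = InterleavingIndex.incl δ 0 ⋙ Z ∧ G = InterleavingIndex.incl δ 1 ⋙ Z

/-- The homotopy interleaving distance, with value `∞` if there is no interleaving. -/
def homotopyInterleavingDist (F G : Bigrade ⥤ CGWH.{u}) : ℝ≥0∞ :=
  sInf {ε | ∃ δ : ℝ≥0, 0 < δ ∧ ε = δ ∧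
    ∃ F' G' : Bigrade ⥤ CGWH.{u},
      WeaklyEquivalent F' F ∧ WeaklyEquivalent G' G ∧ IsInterleaved δ F' G'}

/-! ### The Gromov-Hausdorff-Prokhorov distance -/

/-- The Gromov-Hausdorff-Prokhorov distance between metric probability spaces: the infimum, over
all isometric embeddings into a common complete separable metric space `Z` with its Borel
sigma-algebra, of the maximum of the Hausdorff distance of the images and the Prokhorov distance
of the push-forward measures. It is `∞` if there are no such embeddings. -/
def gromovHausdorffProkhorovDist {X₁ X₂ : Type u}
    [MetricSpace X₁] [MeasurableSpace X₁] [MetricSpace X₂] [MeasurableSpace X₂]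
    (ν₁ : Measure X₁) (ν₂ : Measure X₂) : ℝ≥0∞ :=
  ⨅ (Z : Type u) (_ : MetricSpace Z) (_ : CompleteSpace Z) (_ : SecondCountableTopology Z)
    (_ : MeasurableSpace Z) (_ : BorelSpace Z)
    (φ : X₁ → Z) (ψ : X₂ → Z) (_ : Isometry φ) (_ : Isometry ψ),
    max (Metric.hausdorffEDist (Set.range φ) (Set.range ψ))
      (levyProkhorovEDist (ν₁.map φ) (ν₂.map ψ))

end MeasureDowker

end

noncomputable section

/-! Embed both spaces isometrically in `Z` and let `δ` exceed both the Hausdorff and the Prokhorov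
distance of the images. The two filtrations have different vertex sets, so both are pulled back to
the correspondence `C` of pairs of points at distance at most `δ` in `Z`. The Hausdorff bound makes
both projections of `C` surjective.

Pulling back along a surjection only duplicates vertices: a section of it gives a homotopy inverse,
because the section composed with the surjection is contiguous to the identity
(`comapHomotopyEquiv`). This equivalence is natural in the grade, so the pullbacks are weakly
equivalent to the original filtrations.

On the common vertex set `C` the interleaving consists of plain inclusions
(`measureDowker_comap_le`). The points of `Z` witnessing a simplex at scale `r` form a closed set
`B`. The Prokhorov bound moves its mass to the `δ`-thickening of `B` at a cost of `δ`. Thickening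
and changing vertices each add at most `δ` to distances, so `2r` becomes at most `2(r + δ)`. -/

open scoped Classical in
/-- The pullback of a simplicial complex along a map of vertex sets: a non-empty finite set is a
face if and only if its image is. -/
def PreAbstractSimplicialComplex.comap {V W : Type*} (f : V → W)
    (K : PreAbstractSimplicialComplex W) : PreAbstractSimplicialComplex V where
  faces := {σ | σ.Nonempty ∧ σ.image f ∈ K.faces}
  isRelLowerSet_faces := fun _ hσ => ⟨hσ.1, fun _ hτσ hτ =>
    ⟨hτ, (K.isRelLowerSet_faces hσ.2).2 (Finset.image_subset_image hτσ) (hτ.image f)⟩⟩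

lemma PreAbstractSimplicialComplex.comap_mono {V W : Type*} (f : V → W) :
    Monotone (PreAbstractSimplicialComplex.comap f) :=
  fun _ _ h _ hσ => ⟨hσ.1, h hσ.2⟩

namespace MeasureDowker

/-! ### Maps of realizations induced by maps of vertices -/

namespace Realization

variable {V W : Type u}

/-- A map into a realization with values in a single closed simplex is continuous as soon as its
barycentric coordinates are. -/
lemma continuous_of_support_subset {S : Type*} [TopologicalSpace S]
    {L : PreAbstractSimplicialComplex W} {τ : Finset W} (hτ : τ ∈ L.faces)
    (F : S → Realization L) (hF : ∀ s, (F s).weight.support ⊆ τ)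
    (hc : ∀ w, Continuous fun s => (F s).weight w) : Continuous F := by
  have h : Continuous (fun s => (⟨F s, hF s⟩ : Simplex L τ)) :=
    continuous_induced_rng.2 (continuous_pi hc)
  exact (continuous_incl hτ).comp h

/-- A homotopy on a realization is continuous as soon as it is so on every closed simplex. -/
lemma continuous_homotopy {K : PreAbstractSimplicialComplex V} {Y : Type*} [TopologicalSpace Y]
    {H : unitInterval → Realization K → Y}
    (hH : ∀ σ ∈ K.faces, Continuous fun x : Simplex K σ × unitInterval => H x.2 x.1.incl) :
    Continuous fun x : unitInterval × Realization K => H x.1 x.2 := by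
  have hp (p : Realization K) : Continuous fun t => H t p := by
    -- Every point lies in the closed simplex spanned by its own support.
    let p' : Simplex K p.weight.support := ⟨p, subset_rfl⟩
    exact (hH _ p.support_mem).comp (Continuous.prodMk_right p')
  -- The weak topology controls maps out of the realization, not out of its product with the
  -- interval. Currying turns the homotopy into a map from the realization to the path space, whose
  -- continuity can be tested on simplices; local compactness of the interval allows uncurrying.
  let c : Realization K → C(unitInterval, Y) := fun p => ⟨fun t => H t p, hp p⟩
  have hc : Continuous c := continuous_iff.2 fun σ hσ =>
    ContinuousMap.continuous_of_continuous_uncurry (c ∘ Simplex.incl (σ := σ)) (hH σ hσ)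
  have hu := ContinuousMap.continuous_uncurry_of_continuous ⟨c, hc⟩
  exact hu.comp continuous_swap

lemma mapDomain_nonneg {f : V → W} {x : V →₀ ℝ} (hx : ∀ v, 0 ≤ x v) (w : W) :
    0 ≤ x.mapDomain f w := by
  classical
  rw [Finsupp.mapDomain, Finsupp.sum_apply]
  exact Finset.sum_nonneg fun v _ => by
    dsimp only
    rw [Finsupp.single_apply]; split_ifs <;> simp [hx v]

lemma sum_mapDomain (f : V → W) (x : V →₀ ℝ) :
    (x.mapDomain f).sum (fun _ a => a) = x.sum (fun _ a => a) :=
  Finsupp.sum_mapDomain_index (fun _ => rfl) (fun _ _ _ => rfl)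

/-- On a fixed closed simplex, each pushed-forward coordinate is a sum of coordinates over a subset
of the finite set `σ`, the same for all points. -/
lemma continuous_mapDomain_apply {K : PreAbstractSimplicialComplex V} {σ : Finset V} (f : V → W)
    (w : W) : Continuous fun p : Simplex K σ => p.point.weight.mapDomain f w := by
  classical
  have h : (fun p : Simplex K σ => p.point.weight.mapDomain f w) =
      fun p => ∑ v ∈ σ, if f v = w then p.coord v else 0 := by
    funext p
    rw [Finsupp.mapDomain, Finsupp.sum_apply,
      Finsupp.sum_of_support_subset _ p.support_subset _ (by simp)]
    simp only [Finsupp.single_apply]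
    rfl
  rw [h]
  refine continuous_finsetSum _ fun v _ => ?_
  split_ifs
  · exact (continuous_apply v).comp continuous_induced_dom
  · exact continuous_const

/-- Two maps of vertex sets are contiguous if they send every face into a common face. -/
def Contiguous (K : PreAbstractSimplicialComplex V) (L : PreAbstractSimplicialComplex W)
    (f g : V → W) : Prop :=
  ∀ σ ∈ K.faces, ∃ τ ∈ L.faces, ∀ v ∈ σ, f v ∈ τ ∧ g v ∈ τ

variable {K : PreAbstractSimplicialComplex V} {L : PreAbstractSimplicialComplex W} {f g : V → W}

lemma support_mapDomain_subset {x : V →₀ ℝ} {σ : Finset V} {τ : Finset W} (hx : x.support ⊆ σ)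
    (h : ∀ v ∈ σ, f v ∈ τ) : (x.mapDomain f).support ⊆ τ := by
  classical
  intro w hw
  obtain ⟨v, hv, rfl⟩ := Finset.mem_image.1 (Finsupp.mapDomain_support hw)
  exact h v (hx hv)

lemma support_lineMap_subset {x : V →₀ ℝ} {σ : Finset V} {τ : Finset W} (hx : x.support ⊆ σ)
    (h : ∀ v ∈ σ, f v ∈ τ ∧ g v ∈ τ) (a b : ℝ) :
    (a • x.mapDomain f + b • x.mapDomain g).support ⊆ τ := by
  classical
  exact Finsupp.support_add.trans (Finset.union_subset
    (Finsupp.support_smul.trans (support_mapDomain_subset hx fun v hv => (h v hv).1))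
    (Finsupp.support_smul.trans (support_mapDomain_subset hx fun v hv => (h v hv).2)))

/-- The point of a realization with the given weights, supported in a given face. -/
def ofWeight (L : PreAbstractSimplicialComplex W) (x : W →₀ ℝ) (hx : ∀ w, 0 ≤ x w)
    (hsum : x.sum (fun _ a => a) = 1) (h : ∃ τ ∈ L.faces, x.support ⊆ τ) : Realization L where
  weight := x
  nonneg := hx
  sum_eq_one := hsum
  support_mem := by
    obtain ⟨τ, hτ, hxτ⟩ := h
    -- Only non-empty subsets of a face are faces; the support is non-empty because an empty sum is
    -- not 1.
    refine (L.isRelLowerSet_faces hτ).2 hxτ (Finset.nonempty_iff_ne_empty.2 fun h0 => ?_)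
    rw [Finsupp.sum, h0] at hsum
    simp at hsum

/-- The straight-line homotopy between the maps of realizations induced by contiguous maps. -/
def lineMap (h : Contiguous K L f g) (t : unitInterval) (p : Realization K) : Realization L :=
  ofWeight L ((1 - t : ℝ) • p.weight.mapDomain f + (t : ℝ) • p.weight.mapDomain g)
    (fun w => add_nonneg
      (mul_nonneg (sub_nonneg.2 t.2.2) (mapDomain_nonneg p.nonneg w))
      (mul_nonneg t.2.1 (mapDomain_nonneg p.nonneg w)))
    (by
      rw [Finsupp.sum_add_index' (fun _ => rfl) (fun _ _ _ => rfl),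
        Finsupp.sum_smul_index' (fun _ => rfl), Finsupp.sum_smul_index' (fun _ => rfl),
        ← Finsupp.smul_sum, ← Finsupp.smul_sum, sum_mapDomain, sum_mapDomain, p.sum_eq_one]
      simp)
    (by
      obtain ⟨τ, hτ, h'⟩ := h _ p.support_mem
      exact ⟨τ, hτ, support_lineMap_subset subset_rfl h' _ _⟩)

lemma lineMap_weight_apply (h : Contiguous K L f g) (t : unitInterval) (p : Realization K) (w : W) :
    (lineMap h t p).weight w =
      (1 - t : ℝ) * p.weight.mapDomain f w + (t : ℝ) * p.weight.mapDomain g w :=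
  rfl

lemma support_lineMap (h : Contiguous K L f g) (t : unitInterval) {p : Realization K}
    {σ : Finset V} {τ : Finset W} (hp : p.weight.support ⊆ σ)
    (hτ : ∀ v ∈ σ, f v ∈ τ ∧ g v ∈ τ) : (lineMap h t p).weight.support ⊆ τ :=
  support_lineMap_subset hp hτ _ _

lemma continuous_lineMap (h : Contiguous K L f g) :
    Continuous fun x : unitInterval × Realization K => lineMap h x.1 x.2 := by
  have hs : ∀ σ ∈ K.faces,
      Continuous fun x : Simplex K σ × unitInterval => lineMap h x.2 x.1.incl := by
    intro σ hσ
    obtain ⟨τ, hτ, h'⟩ := h σ hσ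
    refine continuous_of_support_subset hτ _
      (fun x => support_lineMap h x.2 x.1.support_subset h') fun w => ?_
    simp only [lineMap_weight_apply]
    have hf := (continuous_mapDomain_apply (K := K) (σ := σ) f w).comp
      (continuous_fst (Y := unitInterval))
    have hg := (continuous_mapDomain_apply (K := K) (σ := σ) g w).comp
      (continuous_fst (Y := unitInterval))
    have ht : Continuous fun x : Simplex K σ × unitInterval => (x.2 : ℝ) :=
      continuous_subtype_val.comp continuous_snd
    exact ((continuous_const.sub ht).mul hf).add (ht.mul hg)
  exact continuous_homotopy hs

/-- The map of realizations induced by a simplicial map. -/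
def mapVertex (h : Contiguous K L f f) : C(Realization K, Realization L) where
  toFun p := ofWeight L (p.weight.mapDomain f) (mapDomain_nonneg p.nonneg)
    ((sum_mapDomain f _).trans p.sum_eq_one)
    (by
      obtain ⟨τ, hτ, h'⟩ := h _ p.support_mem
      exact ⟨τ, hτ, support_mapDomain_subset subset_rfl fun v hv => (h' v hv).1⟩)
  continuous_toFun := continuous_iff.2 fun σ hσ => by
    obtain ⟨τ, hτ, h'⟩ := h σ hσ
    exact continuous_of_support_subset hτ _
      (fun p => support_mapDomain_subset p.support_subset fun v hv => (h' v hv).1)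
      (continuous_mapDomain_apply f)

/-- Contiguous simplicial maps induce homotopic maps of realizations. -/
lemma homotopic_of_contiguous (h : Contiguous K L f g) (hf : Contiguous K L f f)
    (hg : Contiguous K L g g) : (mapVertex hf).Homotopic (mapVertex hg) :=
  ⟨{ toFun := fun x => lineMap h x.1 x.2
     continuous_toFun := continuous_lineMap h
     map_zero_left := fun p => ext' (by
      change (1 - (0 : ℝ)) • _ + (0 : ℝ) • _ = _
      rw [sub_zero, one_smul, zero_smul, add_zero]; rfl)
     map_one_left := fun p => ext' (by
      change (1 - (1 : ℝ)) • _ + (1 : ℝ) • _ = _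
      rw [sub_self, one_smul, zero_smul, zero_add]; rfl) }⟩

lemma contiguous_comap (L : PreAbstractSimplicialComplex W) (f : V → W) :
    Contiguous (L.comap f) L f f := by
  classical
  intro σ hσ
  refine ⟨σ.image f, ?_, fun v hv => ?_⟩
  · convert hσ.2
  · exact ⟨Finset.mem_image_of_mem f hv, Finset.mem_image_of_mem f hv⟩

lemma contiguous_section {s : W → V} (hs : ∀ w, f (s w) = w) :
    Contiguous L (L.comap f) s s := by
  classical
  intro τ hτ
  refine ⟨τ.image s, ⟨(L.isRelLowerSet_faces hτ).1.image s, ?_⟩, fun v hv =>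
    ⟨Finset.mem_image_of_mem s hv, Finset.mem_image_of_mem s hv⟩⟩
  rw [Finset.image_image, show f ∘ s = id from funext hs, Finset.image_id]
  exact hτ

/-- Whether a set is a face of the pullback depends only on its image under `f`. Adjoining the
points `s (f v)` to a face leaves that image unchanged, so the enlarged set is still a face. -/
lemma contiguous_section_comp {s : W → V} (hs : ∀ w, f (s w) = w) :
    Contiguous (L.comap f) (L.comap f) (s ∘ f) id := by
  classical
  intro σ hσ
  refine ⟨σ ∪ σ.image (s ∘ f), ⟨hσ.1.mono Finset.subset_union_left, ?_⟩, fun v hv =>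
    ⟨Finset.mem_union_right _ (Finset.mem_image_of_mem _ hv), Finset.mem_union_left _ hv⟩⟩
  have h : (f ∘ s ∘ f) = f := funext fun v => hs (f v)
  rw [Finset.image_union, Finset.image_image, h, Finset.union_self]
  exact hσ.2

lemma Contiguous.left (h : Contiguous K L f g) : Contiguous K L f f := fun σ hσ => by
  obtain ⟨τ, hτ, h'⟩ := h σ hσ
  exact ⟨τ, hτ, fun v hv => ⟨(h' v hv).1, (h' v hv).1⟩⟩

lemma Contiguous.right (h : Contiguous K L f g) : Contiguous K L g g := fun σ hσ => by
  obtain ⟨τ, hτ, h'⟩ := h σ hσ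
  exact ⟨τ, hτ, fun v hv => ⟨(h' v hv).2, (h' v hv).2⟩⟩

/-- Pulling back a complex along a surjection of vertex sets does not change the homotopy type. -/
def comapHomotopyEquiv (L : PreAbstractSimplicialComplex W) (f : V → W) (s : W → V)
    (hs : ∀ w, f (s w) = w) :
    ContinuousMap.HomotopyEquiv (Realization (L.comap f)) (Realization L) where
  toFun := mapVertex (contiguous_comap L f)
  invFun := mapVertex (contiguous_section hs)
  left_inv := by
    have h := contiguous_section_comp (L := L) hs
    have h1 : (mapVertex (contiguous_section hs)).comp (mapVertex (contiguous_comap L f)) =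
        mapVertex h.left :=
      ContinuousMap.ext fun p => ext' Finsupp.mapDomain_comp.symm
    have h2 : ContinuousMap.id (Realization (L.comap f)) = mapVertex h.right :=
      ContinuousMap.ext fun p => ext' Finsupp.mapDomain_id.symm
    rw [h1, h2]
    exact homotopic_of_contiguous h _ _
  right_inv := by
    have h1 : (mapVertex (contiguous_comap L f)).comp (mapVertex (contiguous_section hs)) =
        ContinuousMap.id (Realization L) :=
      ContinuousMap.ext fun p => ext' (by
        change Finsupp.mapDomain f (Finsupp.mapDomain s p.weight) = p.weight
        rw [← Finsupp.mapDomain_comp, show f ∘ s = id from funext hs, Finsupp.mapDomain_id])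
    rw [h1]

end Realization

/-! ### Pullbacks of filtrations -/

/-- The pullback of a filtered complex along a map of vertex sets. -/
def comapFiltration {V W : Type*} (f : V → W) (F : Bigrade →o PreAbstractSimplicialComplex W) :
    Bigrade →o PreAbstractSimplicialComplex V where
  toFun t := (F t).comap f
  monotone' := (PreAbstractSimplicialComplex.comap_mono f).comp F.monotone

lemma weaklyEquivalent_comapFiltration {V W : Type u} {f : V → W} (hf : Function.Surjective f)
    (F : Bigrade →o PreAbstractSimplicialComplex W) :
    WeaklyEquivalent (realize (comapFiltration f F)) (realize F) := by
  obtain ⟨s, hs⟩ := hf.hasRightInverse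
  refine .rel _ _ ⟨{
    app := fun t => ObjectProperty.homMk
      (TopCat.ofHom (Realization.mapVertex (Realization.contiguous_comap (F t) f)))
    -- Structure maps keep the weights, and the pushforward of weights along `f` does not involve
    -- the complex, so the squares commute strictly.
    naturality := fun _ _ _ => rfl }, fun t =>
      ⟨Realization.comapHomotopyEquiv (F t) f s hs, rfl⟩⟩

/-- Two filtered complexes on the same vertex set, each included in the shift of the other, have
interleaved realizations. -/
lemma isInterleaved_realize {V : Type u} {δ : ℝ≥0} (F G : Bigrade →o PreAbstractSimplicialComplex V)
    (h : ∀ s t : Bigrade, t.mass ≤ s.mass - δ → s.scale + δ ≤ t.scale → F s ≤ G t ∧ G s ≤ F t) :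
    IsInterleaved δ (realize F) (realize G) := by
  let H : InterleavingIndex δ → PreAbstractSimplicialComplex V :=
    fun a => if a.side = 0 then F a.grade else G a.grade
  have hH : Monotone H := by
    rintro ⟨s, i⟩ ⟨t, j⟩ (⟨hij, hst⟩ | ⟨hij, hm, hr⟩)
    · obtain rfl : i = j := hij
      dsimp only [H]
      split_ifs
      exacts [F.monotone hst, G.monotone hst]
    · fin_cases i <;> fin_cases j
      exacts [(hij rfl).elim, (h s t hm hr).1, (h s t hm hr).2, (hij rfl).elim]
  exact ⟨hH.functor ⋙ realization V, rfl, rfl⟩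

/-! ### The stability theorem -/

/-- Only one of the two Prokhorov inequalities is used, so exchanging the roles of the two spaces
gives the other half of the interleaving. -/
lemma measureDowker_comap_le {X₁ X₂ Z C : Type*}
    [MetricSpace X₁] [MeasurableSpace X₁] [BorelSpace X₁]
    [MetricSpace X₂] [MeasurableSpace X₂] [BorelSpace X₂]
    [MetricSpace Z] [MeasurableSpace Z] [BorelSpace Z]
    {ν₁ : Measure X₁} {ν₂ : Measure X₂} {φ : X₁ → Z} {ψ : X₂ → Z}
    (hφ : Isometry φ) (hψ : Isometry ψ) {δ : ℝ≥0}
    (hν : ∀ B, MeasurableSet B →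
      ν₁.map φ B ≤ ν₂.map ψ (Metric.thickening δ B) + δ)
    {p : C → X₁} {q : C → X₂} (hpq : ∀ c, dist (φ (p c)) (ψ (q c)) ≤ δ)
    {s t : Bigrade} (hm : t.mass ≤ s.mass - δ) (hr : s.scale + δ ≤ t.scale) :
    (measureDowker ν₁ s).comap p ≤ (measureDowker ν₂ t).comap q := by
  classical
  rintro σ ⟨hσ, -, hσm⟩
  refine ⟨hσ, hσ.image _, ?_⟩
  -- The witness set is formed in `Z` rather than in `X₁`, so that it can be thickened and then
  -- measured from the other space. As an intersection of closed balls it is closed, hence Borel.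
  set B : Set Z := ⋂ c ∈ σ, {z | dist (φ (p c)) z ≤ 2 * (s.scale : ℝ)} with hB
  have hBc : IsClosed B := isClosed_biInter fun c _ =>
    isClosed_le (continuous_const.dist continuous_id) continuous_const
  have h₁ : ν₁.map φ B = ν₁ {y | ∀ x ∈ σ.image p, dist x y ≤ 2 * (s.scale : ℝ)} := by
    rw [Measure.map_apply hφ.continuous.measurable hBc.measurableSet]
    congr 1
    ext y
    simp [hB, hφ.dist_eq]
  have h₂ : ν₂.map ψ (Metric.thickening δ B) ≤
      ν₂ {y | ∀ x ∈ σ.image q, dist x y ≤ 2 * (t.scale : ℝ)} := by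
    rw [Measure.map_apply hψ.continuous.measurable Metric.isOpen_thickening.measurableSet]
    refine measure_mono fun y hy x hx => ?_
    obtain ⟨c, hc, rfl⟩ := Finset.mem_image.1 hx
    obtain ⟨z, hz, hyz⟩ := Metric.mem_thickening_iff.1 hy
    have hcz : dist (φ (p c)) z ≤ 2 * (s.scale : ℝ) := Set.mem_iInter₂.1 hz c hc
    have hr' : (s.scale : ℝ) + δ ≤ t.scale := by exact_mod_cast hr
    -- The three legs are less than `δ` (thickening), at most `2 * s.scale` (`z` in `B`) and at most
    -- `δ` (correspondence); they sum to at most `2 * t.scale`.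
    have h := dist_triangle4 (ψ y) z (φ (p c)) (ψ (q c))
    rw [hψ.dist_eq, dist_comm y, dist_comm z] at h
    linarith [hpq c]
  -- Since `t.mass` is positive, `ENNReal.ofReal` does not truncate it, and the additive error `δ`
  -- can be cancelled exactly.
  have h₃ : ENNReal.ofReal t.mass + δ ≤ ENNReal.ofReal s.mass := by
    rw [← ENNReal.ofReal_coe_nnreal, ← ENNReal.ofReal_add t.mass_pos.le δ.coe_nonneg]
    exact ENNReal.ofReal_le_ofReal (by linarith)
  have h₄ := h₃.trans (hσm.trans (h₁.symm.le.trans (hν B hBc.measurableSet)))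
  exact (ENNReal.le_of_add_le_add_right ENNReal.coe_ne_top h₄).trans h₂

lemma homotopyInterleavingDist_measureDowker_le {X₁ X₂ Z : Type u}
    [MetricSpace X₁] [MeasurableSpace X₁] [BorelSpace X₁]
    [MetricSpace X₂] [MeasurableSpace X₂] [BorelSpace X₂]
    [MetricSpace Z] [MeasurableSpace Z] [BorelSpace Z]
    {ν₁ : Measure X₁} {ν₂ : Measure X₂} {φ : X₁ → Z} {ψ : X₂ → Z}
    (hφ : Isometry φ) (hψ : Isometry ψ) {δ : ℝ≥0} (hδ : 0 < δ)
    (hH : Metric.hausdorffEDist (Set.range φ) (Set.range ψ) < δ)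
    (hP : levyProkhorovEDist (ν₁.map φ) (ν₂.map ψ) < δ) :
    homotopyInterleavingDist (realize (measureDowker ν₁)) (realize (measureDowker ν₂)) ≤ δ := by
  -- The correspondence of `δ`-close pairs is the common vertex set. The strict Hausdorff bound
  -- gives every point of either space a partner, even where the infimum of distances is not
  -- attained.
  let C : Type u := {c : X₁ × X₂ // dist (φ c.1) (ψ c.2) ≤ δ}
  let p : C → X₁ := fun c => c.1.1
  let q : C → X₂ := fun c => c.1.2
  have hdist : ∀ {a b : Z}, edist a b < δ → dist a b ≤ δ := fun h => by
    rw [edist_nndist, ENNReal.coe_lt_coe] at h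
    exact_mod_cast h.le
  have hp : Function.Surjective p := fun x => by
    obtain ⟨_, ⟨y, rfl⟩, hxy⟩ :=
      Metric.exists_edist_lt_of_hausdorffEDist_lt (Set.mem_range_self x) hH
    exact ⟨⟨(x, y), hdist hxy⟩, rfl⟩
  have hq : Function.Surjective q := fun y => by
    obtain ⟨_, ⟨x, rfl⟩, hxy⟩ := Metric.exists_edist_lt_of_hausdorffEDist_lt
      (Set.mem_range_self y) (Metric.hausdorffEDist_comm.trans_lt hH)
    exact ⟨⟨(x, y), hdist (by rwa [edist_comm])⟩, rfl⟩
  refine sInf_le ⟨δ, hδ, rfl, _, _, weaklyEquivalent_comapFiltration hp _,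
    weaklyEquivalent_comapFiltration hq _, isInterleaved_realize _ _ fun s t hm hr => ⟨?_, ?_⟩⟩
  · exact measureDowker_comap_le hφ hψ
      (fun B hB => left_measure_le_of_levyProkhorovEDist_lt hP hB) (fun c => c.2) hm hr
  · exact measureDowker_comap_le hψ hφ
      (fun B hB => right_measure_le_of_levyProkhorovEDist_lt hP hB)
      (fun c => (dist_comm _ _).trans_le c.2) hm hr

end MeasureDowker

end

theorem mainTheorem10 {X₁ X₂ : Type u}
    [MetricSpace X₁] [MeasurableSpace X₁] [BorelSpace X₁]
    [MetricSpace X₂] [MeasurableSpace X₂] [BorelSpace X₂]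
    (ν₁ : MeasureTheory.Measure X₁) [MeasureTheory.IsProbabilityMeasure ν₁]
    (ν₂ : MeasureTheory.Measure X₂) [MeasureTheory.IsProbabilityMeasure ν₂] :
    MeasureDowker.homotopyInterleavingDist
        (MeasureDowker.realize (MeasureDowker.measureDowker ν₁))
        (MeasureDowker.realize (MeasureDowker.measureDowker ν₂)) ≤
      MeasureDowker.gromovHausdorffProkhorovDist ν₁ ν₂ := by
  refine le_iInf fun Z => le_iInf fun _ => le_iInf fun _ => le_iInf fun _ => le_iInf fun _ =>
    le_iInf fun _ => le_iInf fun φ => le_iInf fun ψ => le_iInf fun hφ => le_iInf fun hψ => ?_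
  -- Strict room above the maximum yields a finite `δ` larger than both distances. It is
  -- automatically positive, as the interleaving distance requires, and letting `a` decrease
  -- recovers the bound.
  refine le_of_forall_gt fun a ha => ?_
  obtain ⟨δ, hδ, hδa⟩ := ENNReal.lt_iff_exists_nnreal_btwn.1 ha
  obtain ⟨hH, hP⟩ := max_lt_iff.1 hδ
  exact (MeasureDowker.homotopyInterleavingDist_measureDowker_le hφ hψ
    (ENNReal.coe_pos.1 (bot_le.trans_lt hH)) hH hP).trans_lt hδa
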